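/- Let $\mathbb{T}=\mathbb{R}/2\pi\mathbb{Z}$ be the one-dimensional torus with its arc-length distance $|x-y|$ and Lebesgue measure $dx$ of total mass $2\pi$. For an integrable function $f:\mathbb{T}\to\mathbb{R}_{\ge 0}$ write $\overline{f}=\frac{1}{2\pi}\int_{\mathbb{T}} f(x)\,dx$ for its mean value and $\widehat{f}(k)=\frac{1}{2\pi}\int_{\mathbb{T}} f(x)e^{-ikx}\,dx$ for its Fourier coefficients, and let $$ W_1(\mu,\nu)=\inf_{\gamma\in\Gamma(\mu,\nu)}\int_{\mathbb{T}\times\mathbb{T}}|x-y|\,d\gamma(x,y), $$ where $\Gamma(\mu,\nu)$ is the set of all measures on $\mathbb{T}\times\mathbb{T}$ with marginals $\mu$ and $\nu$. There is an absolute constant $c>0$ such that for every integrable $f:\mathbb{T}\to\mathbb{R}_{\ge 0}$ $$ W_1\bigl(f(x)\,dx,\ \overline{f}\,dx\bigr)\ \ge\ \frac{c}{\|f\|_{L^\infty(\mathbb{T})}}\sum_{k\in\mathbb{Z},\ k\ne 0}\frac{1+\log|k|}{k^2}\,|\widehat{f}(k)|^2, $$ where the right-hand side is read as $0$ if $\|f\|_{L^\infty(\mathbb{T})}=\infty$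 or if $f=0$ almost everywhere. -/

import Mathlib

open MeasureTheory
open scoped ENNReal

noncomputable section

/-- The torus `𝕋 = ℝ / 2πℤ`. Its distance is the usual (arc length) one, and `volume` is Lebesgue
measure, of total mass `2π`. -/
abbrev Torus : Type := AddCircle (2 * Real.pi)

instance fact_two_pi_pos : Fact (0 < 2 * Real.pi) := ⟨Real.two_pi_pos⟩

/-- The couplings of `μ` and `ν`: the measures on the product whose marginals are `μ` and `ν`. -/
def couplings {X : Type*} [MeasurableSpace X] (μ ν : Measure X) : Set (Measure (X × X)) :=
  {γ | γ.map Prod.fst = μ ∧ γ.map Prod.snd = ν}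

/-- The `p`-Wasserstein distance: the infimum over all couplings of the transport cost
`∫ |x - y| ^ p dγ(x, y)`, to the power `1 / p`. Its value lies in `[0, ∞]`. -/
def wasserstein {X : Type*} [PseudoEMetricSpace X] [MeasurableSpace X] (p : ℝ)
    (μ ν : Measure X) : ℝ≥0∞ :=
  (⨅ γ ∈ couplings μ ν, ∫⁻ z, edist z.1 z.2 ^ p ∂γ) ^ (1 / p)

/-- The measure `f(x) dx` on the torus, for a nonnegative function `f`. -/
def densityMeasure (f : Torus → ℝ) : Measure Torus :=
  volume.withDensity fun x => ENNReal.ofReal (f x)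

/-- The mean value `f̄ = (1 / 2π) ∫ f(x) dx` of `f` on the torus. -/
def meanValue (f : Torus → ℝ) : ℝ := (1 / (2 * Real.pi)) * ∫ x, f x

/-- The Fourier coefficient `f̂(k) = (1 / 2π) ∫ f(x) e^{-ikx} dx`. -/
def torusFourierCoeff (f : Torus → ℝ) (k : ℤ) : ℂ :=
  fourierCoeff (T := 2 * Real.pi) (fun x => (f x : ℂ)) k

end

/-! ### Ball discrepancies and transport cost. -/

section

open Metric

/-! Compare `μ = f dx` and its mean `ν` on arcs: let `g_r(x) = μ(B(x,r)) - ν(B(x,r))`. For any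
coupling of cost `W`, `‖g_r‖₁ ≤ 4W` (`lintegral_ballDiscrepancy_le`), while `‖g_r‖_∞ ≤ 2rM` when `0
≤ f ≤ M`; hence `‖g_r‖₂² ≤ 8rMW`. As `g_r` is a convolution with the indicator of an arc, its `k`-th
coefficient is `2 sin(kr)/k · f̂(k)` for `k ≠ 0` (`torusFourierCoeff_ballDiscrepancy`). Parseval
gives `∑ sin²(kr) |f̂(k)|²/k² ≤ rMW`. Dividing by `r` and integrating over `0 < r ≤ 3` produces the
logarithm, since `∫ sin²(kr)/r dr ≥ (1 + log|k|)/4`. -/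

theorem volume_closedBall_diff_le (s t : Torus) (r : ℝ) :
    volume (closedBall s r \ closedBall t r) ≤ 2 * edist s t := by
  have hsub : closedBall s r \ closedBall t r ⊆ closedBall s r \ closedBall s (r - dist s t) := by
    rintro x ⟨hx, hxt⟩
    refine ⟨hx, fun h => hxt ?_⟩
    rw [mem_closedBall] at h ⊢
    linarith [dist_triangle x s t]
  have hinc : closedBall s (r - dist s t) ⊆ closedBall s r :=
    closedBall_subset_closedBall (by linarith [dist_nonneg (x := s) (y := t)])
  refine (measure_mono hsub).trans ?_
  rw [measure_sdiff hinc measurableSet_closedBall.nullMeasurableSet (measure_ne_top _ _),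
    AddCircle.volume_closedBall, AddCircle.volume_closedBall, edist_dist, tsub_le_iff_right]
  have h2 : (2 : ℝ≥0∞) = ENNReal.ofReal 2 := by simp
  rw [h2, ← ENNReal.ofReal_mul zero_le_two]
  refine (ENNReal.ofReal_le_ofReal ?_).trans ENNReal.ofReal_add_le
  have := dist_nonneg (x := s) (y := t)
  rcases le_total (2 * Real.pi) (2 * (r - dist s t)) with h | h
  · rw [min_eq_left h]
    exact (min_le_left _ _).trans (by linarith)
  · rw [min_eq_right h]
    exact (min_le_right _ _).trans (by linarith)

/-- The difference of the masses that `μ` and `ν` give to the ball of radius `r` about `x`. -/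
noncomputable def ballDiscrepancy (μ ν : Measure Torus) (r : ℝ) (x : Torus) : ℝ :=
  μ.real (closedBall x r) - ν.real (closedBall x r)

theorem measurable_measureReal_closedBall (μ : Measure Torus) [IsFiniteMeasure μ] (r : ℝ) :
    Measurable fun x => μ.real (closedBall x r) := by
  have hs : MeasurableSet {p : Torus × Torus | dist p.2 p.1 ≤ r} :=
    (isClosed_le (by fun_prop) continuous_const).measurableSet
  exact (measurable_measure_prodMk_left (ν := μ) hs).ennreal_toReal

theorem measurable_ballDiscrepancy (μ ν : Measure Torus) [IsFiniteMeasure μ] [IsFiniteMeasure ν]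
    (r : ℝ) : Measurable (ballDiscrepancy μ ν r) :=
  (measurable_measureReal_closedBall μ r).sub (measurable_measureReal_closedBall ν r)

/-- Only pairs with exactly one point in `B(x,r)` contribute to the discrepancy at `x`. By Tonelli,
each pair is charged the volume of the centres `x` separating its two points, at most four times
their distance. -/
theorem lintegral_ballDiscrepancy_le {μ ν : Measure Torus} [IsFiniteMeasure μ]
    {γ : Measure (Torus × Torus)} (hγ : γ ∈ couplings μ ν) (r : ℝ) :
    ∫⁻ x, ENNReal.ofReal |ballDiscrepancy μ ν r x| ≤ 4 * ∫⁻ z, edist z.1 z.2 ∂γ := by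
  obtain ⟨h1, h2⟩ := hγ
  have hγfin : IsFiniteMeasure γ := by
    refine ⟨?_⟩
    have : μ Set.univ = γ Set.univ := by
      rw [← h1, Measure.map_apply measurable_fst MeasurableSet.univ, Set.preimage_univ]
    rw [← this]
    exact measure_lt_top _ _
  let D : Set (Torus × (Torus × Torus)) :=
    ({p | dist p.2.1 p.1 ≤ r} \ {p | dist p.2.2 p.1 ≤ r}) ∪
      ({p | dist p.2.2 p.1 ≤ r} \ {p | dist p.2.1 p.1 ≤ r})
  have hA : MeasurableSet {p : Torus × (Torus × Torus) | dist p.2.1 p.1 ≤ r} :=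
    (isClosed_le (by fun_prop) continuous_const).measurableSet
  have hB : MeasurableSet {p : Torus × (Torus × Torus) | dist p.2.2 p.1 ≤ r} :=
    (isClosed_le (by fun_prop) continuous_const).measurableSet
  have hD : MeasurableSet D := (hA.diff hB).union (hB.diff hA)
  have hpt : ∀ x, ENNReal.ofReal |ballDiscrepancy μ ν r x| ≤ γ (Prod.mk x ⁻¹' D) := by
    intro x
    have hm1 : MeasurableSet (Prod.fst ⁻¹' closedBall x r : Set (Torus × Torus)) :=
      measurable_fst measurableSet_closedBall
    have hm2 : MeasurableSet (Prod.snd ⁻¹' closedBall x r : Set (Torus × Torus)) :=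
      measurable_snd measurableSet_closedBall
    have e : ballDiscrepancy μ ν r x = γ.real (Prod.fst ⁻¹' closedBall x r)
        - γ.real (Prod.snd ⁻¹' closedBall x r) := by
      rw [ballDiscrepancy, ← h1, ← h2,
        map_measureReal_apply measurable_fst measurableSet_closedBall,
        map_measureReal_apply measurable_snd measurableSet_closedBall]
    rw [e]
    refine (ENNReal.ofReal_le_ofReal
      (abs_measureReal_sub_le_measureReal_symmDiff hm1.nullMeasurableSet hm2.nullMeasurableSet)).trans ?_
    rw [ofReal_measureReal]
    rfl
  calc ∫⁻ x, ENNReal.ofReal |ballDiscrepancy μ ν r x|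
      ≤ ∫⁻ x, γ (Prod.mk x ⁻¹' D) := lintegral_mono hpt
    _ = ∫⁻ z, volume ((fun x => (x, z)) ⁻¹' D) ∂γ := by
      rw [← Measure.prod_apply hD, Measure.prod_apply_symm hD]
    _ ≤ ∫⁻ z, 4 * edist z.1 z.2 ∂γ := by
      refine lintegral_mono fun z => ?_
      have : (fun x => (x, z)) ⁻¹' D =
          (closedBall z.1 r \ closedBall z.2 r) ∪ (closedBall z.2 r \ closedBall z.1 r) := by
        ext x
        simp [D, dist_comm]
      rw [this]
      refine (measure_union_le _ _).trans ?_
      refine (add_le_add (volume_closedBall_diff_le _ _ _) (volume_closedBall_diff_le _ _ _)).trans ?_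
      rw [edist_comm z.2, ← add_mul]
      norm_num
    _ = _ := lintegral_const_mul _ (by fun_prop)

/-! ### Fourier coefficients of the discrepancy. -/

theorem torusFourierCoeff_eq (g : Torus → ℝ) (k : ℤ) :
    torusFourierCoeff g k = ((2 * Real.pi)⁻¹ : ℝ) • ∫ x, fourier (-k) x * (g x : ℂ) := by
  rw [torusFourierCoeff, fourierCoeff, AddCircle.integral_haarAddCircle]
  rfl

/-- Parseval together with `g² ≤ K|g|`; the factor `(2π)⁻¹` converts `volume` to normalised Haar
measure. -/
theorem tsum_sq_torusFourierCoeff_le {g : Torus → ℝ} (hg : Measurable g) {K : ℝ}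
    (hK : ∀ x, |g x| ≤ K) :
    ∑' k : ℤ, ENNReal.ofReal (‖torusFourierCoeff g k‖ ^ 2)
      ≤ ENNReal.ofReal ((2 * Real.pi)⁻¹ * K) * ∫⁻ x, ENNReal.ofReal |g x| := by
  have hm : Measurable fun x => (g x : ℂ) := Complex.measurable_ofReal.comp hg
  have hb : ∀ x, ‖(g x : ℂ)‖ ≤ K := fun x => by simpa using hK x
  have hK0 : 0 ≤ K := (abs_nonneg _).trans (hK 0)
  have hL : MemLp (fun x => (g x : ℂ)) 2 (AddCircle.haarAddCircle (T := 2 * Real.pi)) :=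
    MemLp.of_bound hm.aestronglyMeasurable K (ae_of_all _ hb)
  have hsum := hasSum_sq_fourierCoeff hL.toLp
  have hcoe := hL.coeFn_toLp
  have hcf : ∀ k, fourierCoeff hL.toLp k = torusFourierCoeff g k :=
    fun k => congrFun (fourierCoeff_congr_ae hcoe) k
  simp only [hcf] at hsum
  have hsq : ∀ᵐ x ∂(AddCircle.haarAddCircle (T := 2 * Real.pi)),
      ‖(hL.toLp : Torus → ℂ) x‖ ^ 2 = g x ^ 2 := by
    filter_upwards [hcoe] with x hx
    rw [hx, Complex.norm_real, Real.norm_eq_abs, sq_abs]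
  rw [← ENNReal.ofReal_tsum_of_nonneg (fun k => sq_nonneg ‖torusFourierCoeff g k‖) hsum.summable,
    hsum.tsum_eq,
    integral_congr_ae hsq, AddCircle.integral_haarAddCircle, smul_eq_mul]
  have hint : Integrable (fun x => |g x|) (volume : Measure Torus) :=
    Integrable.of_bound hg.norm.aestronglyMeasurable K (ae_of_all _ fun x => by simpa using hK x)
  rw [← ofReal_integral_eq_lintegral_ofReal hint (ae_of_all _ fun x => abs_nonneg (g x)),
    ← ENNReal.ofReal_mul (by positivity), mul_assoc, ← integral_const_mul K]
  apply ENNReal.ofReal_le_ofReal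
  refine mul_le_mul_of_nonneg_left ?_ (inv_nonneg.mpr Real.two_pi_pos.le)
  refine integral_mono_of_nonneg (ae_of_all _ fun x => sq_nonneg _) (hint.const_mul K)
    (ae_of_all _ fun x => ?_)
  beta_reduce
  rw [← sq_abs, sq]
  exact mul_le_mul_of_nonneg_right (hK x) (abs_nonneg _)

theorem setIntegral_fourier_closedBall_zero {k : ℤ} (hk : k ≠ 0) {r : ℝ} (hr : 0 ≤ r)
    (hrπ : r < Real.pi) :
    ∫ x in closedBall (0 : Torus) r, (fourier (-k) x : ℂ)
      = ((2 * Real.sin (k * r) / k : ℝ) : ℂ) := by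
  -- Since `r < π`, the ball lifts to a single interval in one period.
  have hpre : ((↑) : ℝ → Torus) ⁻¹' closedBall 0 r ∩ Set.Ioc (-Real.pi) (-Real.pi + 2 * Real.pi)
      = Set.Icc (-r) r := by
    have := AddCircle.coe_real_preimage_closedBall_inter_eq (p := 2 * Real.pi) (x := 0) (ε := r)
      (Set.Ioc (-Real.pi) (-Real.pi + 2 * Real.pi)) (by
        rw [abs_of_pos Real.two_pi_pos, Real.closedBall_eq_Icc]
        intro y hy
        constructor <;> linarith [hy.1, hy.2])
    rw [AddCircle.coe_zero, abs_of_pos Real.two_pi_pos, if_pos (by linarith),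
      Real.closedBall_eq_Icc, zero_sub, zero_add] at this
    rw [this, Set.inter_eq_left]
    intro y hy
    constructor <;> linarith [hy.1, hy.2]
  have hkc : (-(k : ℂ) * Complex.I) ≠ 0 := by simp [hk]
  rw [← integral_indicator measurableSet_closedBall,
    ← AddCircle.integral_preimage (2 * Real.pi) (-Real.pi)]
  have hind : ∀ a : ℝ, (closedBall (0 : Torus) r).indicator (fun x => (fourier (-k) x : ℂ)) (a : Torus)
      = (((↑) : ℝ → Torus) ⁻¹' closedBall 0 r).indicator
        (fun a : ℝ => Complex.exp (-(k : ℂ) * Complex.I * a)) a := by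
    intro a
    by_cases ha : (a : Torus) ∈ closedBall (0 : Torus) r
    · rw [Set.indicator_of_mem ha, Set.indicator_of_mem (Set.mem_preimage.mpr ha), fourier_coe_apply]
      congr 1
      have : (Real.pi : ℂ) ≠ 0 := by exact_mod_cast Real.pi_ne_zero
      push_cast
      field_simp
    · rw [Set.indicator_of_notMem ha, Set.indicator_of_notMem (Set.mem_preimage.not.mpr ha)]
  simp only [hind]
  rw [integral_indicator (AddCircle.measurable_mk' measurableSet_closedBall),
    Measure.restrict_restrict (AddCircle.measurable_mk' measurableSet_closedBall), hpre,
    integral_Icc_eq_integral_Ioc, ← intervalIntegral.integral_of_le (by linarith),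
    integral_exp_mul_complex hkc]
  have hk' : (k : ℂ) ≠ 0 := by exact_mod_cast hk
  have hs := Complex.two_sin ((k : ℂ) * r)
  push_cast
  rw [hs]
  field_simp
  ring_nf
  simp only [Complex.I_sq]
  ring_nf

theorem setIntegral_fourier_closedBall {k : ℤ} (hk : k ≠ 0) {r : ℝ} (hr : 0 ≤ r)
    (hrπ : r < Real.pi) (t : Torus) :
    ∫ x in closedBall t r, (fourier (-k) x : ℂ)
      = ((2 * Real.sin (k * r) / k : ℝ) : ℂ) * fourier (-k) t := by
  rw [← setIntegral_fourier_closedBall_zero hk hr hrπ,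
    ← integral_indicator measurableSet_closedBall, ← integral_indicator measurableSet_closedBall,
    ← integral_mul_const, ← integral_add_right_eq_self _ t]
  refine integral_congr_ae (ae_of_all _ fun x => ?_)
  have : x + t ∈ closedBall t r ↔ x ∈ closedBall (0 : Torus) r := by
    simp [mem_closedBall, dist_eq_norm]
  by_cases hx : x ∈ closedBall (0 : Torus) r
  · simp only [Set.indicator, this, hx, if_true]
    simp [fourier_apply, AddCircle.toCircle_add, smul_add]
  · simp only [Set.indicator, this, hx, if_false, zero_mul]

/-- Fubini: for fixed `t`, the centres `x` with `t ∈ B(x,r)` form the ball about `t`. -/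
theorem integral_fourier_mul_measureReal_closedBall (μ : Measure Torus) [IsFiniteMeasure μ] {k : ℤ}
    (hk : k ≠ 0) {r : ℝ} (hr : 0 ≤ r) (hrπ : r < Real.pi) :
    ∫ x, (fourier (-k) x : ℂ) * (μ.real (closedBall x r) : ℂ)
      = ((2 * Real.sin (k * r) / k : ℝ) : ℂ) * ∫ t, (fourier (-k) t : ℂ) ∂μ := by
  have hs : MeasurableSet {p : Torus × Torus | dist p.1 p.2 ≤ r} :=
    (isClosed_le (by fun_prop) continuous_const).measurableSet
  have hmeas : Measurable fun p : Torus × Torus => (fourier (-k) p.1 : ℂ) :=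
    ((fourier (-k)).continuous.comp continuous_fst).measurable
  let F : Torus → Torus → ℂ := fun x t =>
    {p : Torus × Torus | dist p.1 p.2 ≤ r}.indicator (fun p => (fourier (-k) p.1 : ℂ)) (x, t)
  have hint : Integrable (Function.uncurry F) (volume.prod μ) := by
    refine Integrable.of_bound (hmeas.indicator hs).aestronglyMeasurable 1 (ae_of_all _ fun p => ?_)
    refine (norm_indicator_le_norm_self (fun p : Torus × Torus => (fourier (-k) p.1 : ℂ)) p).trans ?_
    rw [fourier_apply, Circle.norm_coe]
  have h1 : ∀ x, ∫ t, F x t ∂μ = (fourier (-k) x : ℂ) * (μ.real (closedBall x r) : ℂ) := by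
    intro x
    have : ∀ t, F x t = (closedBall x r).indicator (fun _ => (fourier (-k) x : ℂ)) t := by
      intro t
      simp [F, Set.indicator, mem_closedBall, dist_comm]
    simp only [this]
    rw [integral_indicator_const _ measurableSet_closedBall, Complex.real_smul, mul_comm]
  have h2 : ∀ t, ∫ x, F x t = ((2 * Real.sin (k * r) / k : ℝ) : ℂ) * fourier (-k) t := by
    intro t
    rw [← setIntegral_fourier_closedBall hk hr hrπ, ← integral_indicator measurableSet_closedBall]
    rfl
  calc _ = ∫ x, ∫ t, F x t ∂μ := by simp only [h1]
    _ = ∫ t, (∫ x, F x t) ∂μ := integral_integral_swap hint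
    _ = _ := by simp only [h2]; rw [integral_const_mul]

theorem integral_fourier_densityMeasure {f : Torus → ℝ} (hf : Integrable f volume)
    (hf0 : ∀ᵐ x ∂volume, 0 ≤ f x) (k : ℤ) :
    ∫ t, (fourier (-k) t : ℂ) ∂densityMeasure f = ((2 * Real.pi : ℝ) : ℂ) * torusFourierCoeff f k := by
  rw [densityMeasure, integral_withDensity_eq_integral_toReal_smul₀
    hf.aestronglyMeasurable.aemeasurable.ennreal_ofReal (ae_of_all _ fun x => ENNReal.ofReal_lt_top),
    torusFourierCoeff_eq, Complex.real_smul, ← mul_assoc, ← Complex.ofReal_mul,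
    mul_inv_cancel₀ Real.two_pi_pos.ne', Complex.ofReal_one, one_mul]
  refine integral_congr_ae ?_
  filter_upwards [hf0] with x hx
  rw [ENNReal.toReal_ofReal hx, Complex.real_smul, mul_comm]

theorem integral_fourier_neg {k : ℤ} (hk : k ≠ 0) : ∫ x : Torus, (fourier (-k) x : ℂ) = 0 :=
  integral_eq_zero_of_add_right_eq_neg
    (fourier_add_half_inv_index (neg_ne_zero.mpr hk) Real.two_pi_pos)

theorem isFiniteMeasure_densityMeasure {f : Torus → ℝ} (hf : Integrable f volume) :
    IsFiniteMeasure (densityMeasure f) :=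
  isFiniteMeasure_withDensity_ofReal hf.2

theorem torusFourierCoeff_ballDiscrepancy {f : Torus → ℝ} (hf : Integrable f volume)
    (hf0 : ∀ᵐ x ∂volume, 0 ≤ f x) (c : ℝ) {k : ℤ} (hk : k ≠ 0) {r : ℝ} (hr : 0 ≤ r)
    (hrπ : r < Real.pi) :
    torusFourierCoeff (ballDiscrepancy (densityMeasure f) (densityMeasure fun _ => c) r) k
      = ((2 * Real.sin (k * r) / k : ℝ) : ℂ) * torusFourierCoeff f k := by
  have := isFiniteMeasure_densityMeasure hf
  have := isFiniteMeasure_densityMeasure (integrable_const (μ := (volume : Measure Torus)) c)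
  have hint : ∀ μ : Measure Torus, IsFiniteMeasure μ →
      Integrable fun x => (fourier (-k) x : ℂ) * (μ.real (closedBall x r) : ℂ) := by
    intro μ _
    refine Integrable.of_bound (C := μ.real Set.univ) ?_ (ae_of_all _ fun x => ?_)
    · exact ((fourier (-k)).continuous.measurable.mul (Complex.measurable_ofReal.comp
        (measurable_measureReal_closedBall μ r))).aestronglyMeasurable
    · rw [norm_mul, fourier_apply, Circle.norm_coe, one_mul, Complex.norm_real, Real.norm_eq_abs,
        abs_of_nonneg measureReal_nonneg]
      exact measureReal_mono (Set.subset_univ _)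
  have hconst : ∫ t, (fourier (-k) t : ℂ) ∂densityMeasure (fun _ => c) = 0 := by
    rw [densityMeasure, withDensity_const, integral_smul_measure, integral_fourier_neg hk, smul_zero]
  rw [torusFourierCoeff_eq]
  simp only [ballDiscrepancy, Complex.ofReal_sub, mul_sub]
  rw [integral_sub (hint _ inferInstance) (hint _ inferInstance),
    integral_fourier_mul_measureReal_closedBall _ hk hr hrπ,
    integral_fourier_mul_measureReal_closedBall _ hk hr hrπ, hconst,
    integral_fourier_densityMeasure hf hf0, mul_zero, sub_zero, Complex.real_smul]
  have : ((2 * Real.pi : ℝ) : ℂ) ≠ 0 := by exact_mod_cast Real.two_pi_pos.ne'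
  rw [Complex.ofReal_inv]
  field_simp

end

/-! ### The logarithmic lower bound. -/

section

open Set Real

theorem one_add_log_le_integral_sin_sq_div {k : ℝ} (hk : 1 ≤ k) :
    (1 + log k) / 4 ≤ ∫ r in (1 / k)..3, sin (k * r) ^ 2 / r := by
  have hk0 : 0 < k := by linarith
  have hk3 : 1 / k ≤ 3 := by
    rw [div_le_iff₀ hk0]; linarith
  have hpos : ∀ x ∈ Icc (1 / k) 3, 0 < x := fun x hx => lt_of_lt_of_le (by positivity) hx.1
  -- Write `sin² = (1 - cos)/2` and integrate the cosine by parts once. The term `1/(2kr)` absorbs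
  -- the sign of the remainder, so that `F' ≤ sin²(kr)/r`.
  let F : ℝ → ℝ := fun r => (log r - sin (2 * k * r) / (2 * k * r) + 1 / (2 * k * r)) / 2
  let F' : ℝ → ℝ := fun r => (r⁻¹ - (cos (2 * k * r) * (2 * k) * (2 * k * r) - sin (2 * k * r) * (2 * k))
    / (2 * k * r) ^ 2 + (0 * (2 * k * r) - 1 * (2 * k)) / (2 * k * r) ^ 2) / 2
  have hF : ∀ x, 0 < x → HasDerivAt F (F' x) x := by
    intro x hx
    have hl : HasDerivAt (fun r : ℝ => 2 * k * r) (2 * k) x := by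
      simpa using (hasDerivAt_id x).const_mul (2 * k)
    have hne : 2 * k * x ≠ 0 := by positivity
    exact ((((hasDerivAt_log hx.ne').sub (hl.sin.div hl hne)).add
      ((hasDerivAt_const x (1 : ℝ)).div hl hne)).div_const 2)
  have hle : F 3 - F (1 / k) ≤ ∫ r in (1 / k)..3, sin (k * r) ^ 2 / r := by
    refine intervalIntegral.sub_le_integral_of_hasDeriv_right_of_le hk3
      (fun x hx => (hF x (hpos x hx)).continuousAt.continuousWithinAt)
      (fun x hx => (hF x (hpos x (Ioo_subset_Icc_self hx))).hasDerivWithinAt)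
      (ContinuousOn.integrableOn_Icc ?_) (fun x hx => ?_)
    · exact ContinuousOn.div (by fun_prop) continuousOn_id fun x hx => (hpos x hx).ne'
    · have hx := hpos x (Ioo_subset_Icc_self hx)
      have h2 : cos (2 * k * x) = 1 - 2 * sin (k * x) ^ 2 := by
        rw [mul_assoc, cos_two_mul, cos_sq']; ring
      have e : F' x = sin (k * x) ^ 2 / x - (1 - sin (2 * k * x)) / (4 * k * x ^ 2) := by
        simp only [F', h2]
        field_simp
        ring
      rw [e]
      have : 0 ≤ (1 - sin (2 * k * x)) / (4 * k * x ^ 2) :=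
        div_nonneg (by linarith [sin_le_one (2 * k * x)]) (by positivity)
      linarith
  refine le_trans ?_ hle
  have h3 : 1 ≤ log 3 := by
    rw [le_log_iff_exp_le (by norm_num)]
    linarith [exp_one_lt_d9]
  have e1 : F (1 / k) = (- log k - sin 2 / 2 + 1 / 2) / 2 := by
    have : 2 * k * (1 / k) = 2 := by field_simp
    simp only [F, this]
    simp only [one_div, log_inv]
  have e3 : F 3 = (log 3 + (1 - sin (2 * k * 3)) / (2 * k * 3)) / 2 := by
    simp only [F]; ring
  have : 0 ≤ (1 - sin (2 * k * 3)) / (2 * k * 3) :=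
    div_nonneg (by linarith [sin_le_one (2 * k * 3)]) (by positivity)
  have hs : 0 < sin 2 := sin_pos_of_pos_of_lt_pi (by norm_num) (by linarith [pi_gt_three])
  have hl := log_nonneg hk
  rw [e1, e3]
  linarith

theorem ofReal_one_add_log_le_lintegral_sin_sq_div {k : ℝ} (hk : 1 ≤ |k|) :
    ENNReal.ofReal ((1 + log |k|) / 4)
      ≤ ∫⁻ r in Ioc (0 : ℝ) 3, ENNReal.ofReal (sin (k * r) ^ 2 / r) := by
  have hk0 : 0 < |k| := by linarith
  have hk3 : 1 / |k| ≤ 3 := by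
    rw [div_le_iff₀ hk0]; linarith
  have hpos : ∀ x ∈ Icc (1 / |k|) 3, 0 < x := fun x hx => lt_of_lt_of_le (by positivity) hx.1
  have habs : ∀ r : ℝ, sin (|k| * r) ^ 2 = sin (k * r) ^ 2 := by
    intro r
    rcases abs_choice k with h | h <;> simp [h]
  refine (ENNReal.ofReal_le_ofReal (one_add_log_le_integral_sin_sq_div hk)).trans ?_
  rw [intervalIntegral.integral_of_le hk3]
  simp only [habs]
  rw [ofReal_integral_eq_lintegral_ofReal]
  · exact lintegral_mono_set (Ioc_subset_Ioc_left (by positivity))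
  · refine (ContinuousOn.integrableOn_Icc ?_).mono_set Ioc_subset_Icc_self
    exact ContinuousOn.div (by fun_prop) continuousOn_id fun x hx => (hpos x hx).ne'
  · filter_upwards [ae_restrict_mem measurableSet_Ioc] with x hx
    have := hpos x (Ioc_subset_Icc_self hx)
    positivity

end

/-! ### Combining the estimates. -/

open Metric

theorem measureReal_closedBall_densityMeasure_le {f : Torus → ℝ} {M r : ℝ} (hM : 0 ≤ M)
    (hr : 0 ≤ r) (hf : ∀ᵐ x ∂volume, f x ≤ M) (x : Torus) :
    (densityMeasure f).real (closedBall x r) ≤ 2 * r * M := by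
  refine ENNReal.toReal_le_of_le_ofReal (by positivity) ?_
  rw [densityMeasure, withDensity_apply _ measurableSet_closedBall]
  calc ∫⁻ y in closedBall x r, ENNReal.ofReal (f y)
      ≤ ∫⁻ _ in closedBall x r, ENNReal.ofReal M :=
        lintegral_mono_ae (ae_restrict_of_ae (hf.mono fun y hy => ENNReal.ofReal_le_ofReal hy))
    _ = ENNReal.ofReal M * volume (closedBall x r) := setLIntegral_const _ _
    _ ≤ ENNReal.ofReal M * ENNReal.ofReal (2 * r) := by
        rw [AddCircle.volume_closedBall]
        gcongr
        exact min_le_right _ _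
    _ = ENNReal.ofReal (2 * r * M) := by
        rw [← ENNReal.ofReal_mul hM, mul_comm]

theorem meanValue_le {f : Torus → ℝ} {M : ℝ} (hfi : Integrable f volume)
    (hf : ∀ᵐ x ∂volume, f x ≤ M) : meanValue f ≤ M := by
  have h := integral_mono_ae hfi (integrable_const M) hf
  rw [integral_const, measureReal_def, AddCircle.measure_univ,
    ENNReal.toReal_ofReal Real.two_pi_pos.le, smul_eq_mul] at h
  rw [meanValue, one_div, inv_mul_le_iff₀ Real.two_pi_pos]
  exact h

theorem tsum_sin_sq_le_of_mem_couplings {f : Torus → ℝ} (hfi : Integrable f volume)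
    (hf0 : ∀ᵐ x ∂volume, 0 ≤ f x) {M : ℝ} (hM : 0 ≤ M) (hf : ∀ᵐ x ∂volume, f x ≤ M)
    {γ : Measure (Torus × Torus)}
    (hγ : γ ∈ couplings (densityMeasure f) (densityMeasure fun _ => meanValue f))
    {r : ℝ} (hr : 0 ≤ r) (hrπ : r < Real.pi) :
    ∑' k : {k : ℤ // k ≠ 0}, ENNReal.ofReal
        (Real.sin ((k : ℤ) * r) ^ 2 * (‖torusFourierCoeff f k‖ ^ 2 / ((k : ℤ) : ℝ) ^ 2))
      ≤ ENNReal.ofReal (r * M) * ∫⁻ z, edist z.1 z.2 ∂γ := by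
  have := isFiniteMeasure_densityMeasure hfi
  have := isFiniteMeasure_densityMeasure
    (integrable_const (μ := (volume : Measure Torus)) (meanValue f))
  set g := ballDiscrepancy (densityMeasure f) (densityMeasure fun _ => meanValue f) r with hg
  have hgb : ∀ x, |g x| ≤ 2 * r * M := fun x =>
    abs_sub_le_of_nonneg_of_le measureReal_nonneg
      (measureReal_closedBall_densityMeasure_le hM hr hf x) measureReal_nonneg
      (measureReal_closedBall_densityMeasure_le hM hr (ae_of_all _ fun _ => meanValue_le hfi hf) x)
  have hcoef : ∀ k : {k : ℤ // k ≠ 0}, ENNReal.ofReal (‖torusFourierCoeff g k‖ ^ 2)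
      = 4 * ENNReal.ofReal
        (Real.sin ((k : ℤ) * r) ^ 2 * (‖torusFourierCoeff f k‖ ^ 2 / ((k : ℤ) : ℝ) ^ 2)) := by
    intro k
    have h4 : (4 : ℝ≥0∞) = ENNReal.ofReal 4 := by simp
    rw [hg, torusFourierCoeff_ballDiscrepancy hfi hf0 _ k.2 hr hrπ, norm_mul, mul_pow,
      Complex.norm_real, Real.norm_eq_abs, sq_abs, h4, ← ENNReal.ofReal_mul (by norm_num)]
    congr 1
    ring
  -- The `4` on the left is the square of the `2` in `2 sin(kr)/k`; it cancels the `4` of the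
  -- transport bound.
  have hle : 4 * ∑' k : {k : ℤ // k ≠ 0}, ENNReal.ofReal
        (Real.sin ((k : ℤ) * r) ^ 2 * (‖torusFourierCoeff f k‖ ^ 2 / ((k : ℤ) : ℝ) ^ 2))
      ≤ 4 * (ENNReal.ofReal (r * M) * ∫⁻ z, edist z.1 z.2 ∂γ) := by
    rw [← ENNReal.tsum_mul_left]
    simp only [← hcoef]
    calc ∑' k : {k : ℤ // k ≠ 0}, ENNReal.ofReal (‖torusFourierCoeff g k‖ ^ 2)
        ≤ ∑' k : ℤ, ENNReal.ofReal (‖torusFourierCoeff g k‖ ^ 2) :=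
          ENNReal.tsum_comp_le_tsum_of_injective Subtype.val_injective _
      _ ≤ ENNReal.ofReal ((2 * Real.pi)⁻¹ * (2 * r * M)) * ∫⁻ x, ENNReal.ofReal |g x| :=
          tsum_sq_torusFourierCoeff_le (measurable_ballDiscrepancy _ _ _) hgb
      _ ≤ ENNReal.ofReal (r * M) * (4 * ∫⁻ z, edist z.1 z.2 ∂γ) := by
          refine mul_le_mul' (ENNReal.ofReal_le_ofReal ?_) (lintegral_ballDiscrepancy_le hγ r)
          rw [inv_mul_le_iff₀ Real.two_pi_pos]
          have := mul_nonneg hr hM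
          nlinarith [Real.pi_gt_three]
      _ = _ := by ring
  exact (ENNReal.mul_le_mul_iff_right (by norm_num) (by norm_num)).mp hle

theorem tsum_one_add_log_le_of_mem_couplings {f : Torus → ℝ} (hfi : Integrable f volume)
    (hf0 : ∀ᵐ x ∂volume, 0 ≤ f x) {M : ℝ} (hM : 0 ≤ M) (hf : ∀ᵐ x ∂volume, f x ≤ M)
    {γ : Measure (Torus × Torus)}
    (hγ : γ ∈ couplings (densityMeasure f) (densityMeasure fun _ => meanValue f)) :
    ∑' k : {k : ℤ // k ≠ 0}, ENNReal.ofReal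
        ((1 + Real.log |((k : ℤ) : ℝ)|) / ((k : ℤ) : ℝ) ^ 2 * ‖torusFourierCoeff f k‖ ^ 2)
      ≤ 12 * (ENNReal.ofReal M * ∫⁻ z, edist z.1 z.2 ∂γ) := by
  set W := ∫⁻ z, edist z.1 z.2 ∂γ
  let a : {k : ℤ // k ≠ 0} → ℝ := fun k => ‖torusFourierCoeff f k‖ ^ 2 / ((k : ℤ) : ℝ) ^ 2
  have ha : ∀ k, 0 ≤ a k := fun k => by positivity
  have hterm : ∀ k : {k : ℤ // k ≠ 0}, ENNReal.ofReal
      ((1 + Real.log |((k : ℤ) : ℝ)|) / ((k : ℤ) : ℝ) ^ 2 * ‖torusFourierCoeff f k‖ ^ 2)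
      ≤ 4 * ∫⁻ r in Set.Ioc (0 : ℝ) 3,
        ENNReal.ofReal (Real.sin ((k : ℤ) * r) ^ 2 / r) * ENNReal.ofReal (a k) := by
    intro k
    have hk : 1 ≤ |((k : ℤ) : ℝ)| := by
      exact_mod_cast Int.one_le_abs k.2
    rw [lintegral_mul_const' _ _ ENNReal.ofReal_ne_top]
    have h4 : (4 : ℝ≥0∞) = ENNReal.ofReal 4 := by simp
    have hl := Real.log_nonneg hk
    calc _ = 4 * (ENNReal.ofReal ((1 + Real.log |((k : ℤ) : ℝ)|) / 4) * ENNReal.ofReal (a k)) := by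
          rw [h4, ← ENNReal.ofReal_mul (by positivity), ← ENNReal.ofReal_mul (by norm_num)]
          congr 1
          simp only [a]
          ring
      _ ≤ _ := by
          gcongr
          exact ofReal_one_add_log_le_lintegral_sin_sq_div hk
  calc _ ≤ ∑' k : {k : ℤ // k ≠ 0}, 4 * ∫⁻ r in Set.Ioc (0 : ℝ) 3,
        ENNReal.ofReal (Real.sin ((k : ℤ) * r) ^ 2 / r) * ENNReal.ofReal (a k) :=
        ENNReal.tsum_le_tsum hterm
    _ = 4 * ∫⁻ r in Set.Ioc (0 : ℝ) 3, ∑' k : {k : ℤ // k ≠ 0},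
        ENNReal.ofReal (Real.sin ((k : ℤ) * r) ^ 2 / r) * ENNReal.ofReal (a k) := by
        rw [ENNReal.tsum_mul_left, lintegral_tsum fun k => by fun_prop]
    -- The weight `1/r` cancels the factor `r` gained from the sup bound, so the integrand stays
    -- bounded near `0`. The cutoff `3` lies below `π`, and `12 = 4 · 3`.
    _ ≤ 4 * ∫⁻ r in Set.Ioc (0 : ℝ) 3, ENNReal.ofReal M * W := by
        refine mul_le_mul_right (setLIntegral_mono measurable_const fun r hr => ?_) _
        have hr0 : 0 < r := hr.1
        have hs := tsum_sin_sq_le_of_mem_couplings hfi hf0 hM hf hγ hr0.le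
          (hr.2.trans_lt Real.pi_gt_three)
        calc _ = ∑' k : {k : ℤ // k ≠ 0}, ENNReal.ofReal r⁻¹ *
              ENNReal.ofReal (Real.sin ((k : ℤ) * r) ^ 2 * a k) := by
              refine tsum_congr fun k => ?_
              rw [← ENNReal.ofReal_mul (by positivity), ← ENNReal.ofReal_mul (by positivity)]
              congr 1
              ring
          _ ≤ ENNReal.ofReal r⁻¹ * (ENNReal.ofReal (r * M) * W) := by
              rw [ENNReal.tsum_mul_left]
              gcongr
          _ = ENNReal.ofReal M * W := by
              rw [← mul_assoc, ← ENNReal.ofReal_mul (by positivity), inv_mul_cancel_left₀ hr0.ne']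
    _ = 12 * (ENNReal.ofReal M * W) := by
        rw [setLIntegral_const, Real.volume_Ioc, sub_zero, ENNReal.ofReal_ofNat]
        ring

theorem theorem2 :
    ∃ c : ℝ, 0 < c ∧ ∀ f : Torus → ℝ, Integrable f volume → (∀ᵐ x ∂volume, 0 ≤ f x) →
      ENNReal.ofReal c * ((eLpNorm f ∞ volume)⁻¹ *
          ∑' k : {k : ℤ // k ≠ 0}, ENNReal.ofReal
            ((1 + Real.log |((k : ℤ) : ℝ)|) / ((k : ℤ) : ℝ) ^ 2 * ‖torusFourierCoeff f k‖ ^ 2))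
        ≤ wasserstein 1 (densityMeasure f) (densityMeasure fun _ => meanValue f) := by
  refine ⟨1 / 12, by norm_num, fun f hfi hf0 => ?_⟩
  rw [wasserstein, one_div_one, ENNReal.rpow_one, one_div]
  refine le_iInf₂ fun γ hγ => ?_
  simp only [ENNReal.rpow_one]
  set N := eLpNorm f ∞ volume with hN
  rcases eq_or_ne N ⊤ with htop | htop
  · simp [htop]
  -- Here `N⁻¹ = ⊤`, but every coefficient vanishes and `⊤ * 0 = 0`.
  rcases eq_or_ne N 0 with hzero | hzero
  · have hae : f =ᵐ[volume] 0 := (eLpNorm_eq_zero_iff hfi.aestronglyMeasurable (by simp)).mp hzero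
    have hc : ∀ k, torusFourierCoeff f k = 0 := by
      intro k
      rw [torusFourierCoeff_eq, integral_congr_ae (g := fun _ => 0), integral_zero, smul_zero]
      filter_upwards [hae] with x hx
      simp [hx]
    simp [hc]
  have hf : ∀ᵐ x ∂volume, f x ≤ N.toReal := by
    have h := ae_le_eLpNormEssSup (f := f) (μ := volume)
    rw [← eLpNorm_exponent_top, ← hN] at h
    filter_upwards [h] with x hx
    refine (le_abs_self _).trans ?_
    rw [← Real.norm_eq_abs, ← toReal_enorm]
    exact ENNReal.toReal_mono htop hx
  have hS := tsum_one_add_log_le_of_mem_couplings hfi hf0 ENNReal.toReal_nonneg hf hγ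
  rw [ENNReal.ofReal_toReal htop] at hS
  calc _ ≤ ENNReal.ofReal (12⁻¹) * (N⁻¹ * (12 * (N * ∫⁻ z, edist z.1 z.2 ∂γ))) := by
        gcongr
    _ = (ENNReal.ofReal (12⁻¹) * 12) * (N⁻¹ * N) * ∫⁻ z, edist z.1 z.2 ∂γ := by ring
    _ = _ := by
        rw [ENNReal.inv_mul_cancel hzero htop, ENNReal.ofReal_inv_of_pos (by norm_num),
          ENNReal.ofReal_ofNat, ENNReal.inv_mul_cancel (by norm_num) (by norm_num), one_mul, one_mul]
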